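/- Let $S^1=\mathbb R/2\pi\mathbb Z$ and let $f\colon\mathbb R\to\mathbb R$ be smooth. For real-valued functions $v$ on $S^1$ with Fourier coefficients $v_k$ let $\|v\|_{L^2}^2=\sum_{k\in\mathbb Z}|v_k|^2$ and $\|v\|_{H^1}^2=\sum_{k\in\mathbb Z}(1+k^2)|v_k|^2$; for $h>0$ let $H^1_h(S^1)$ be the space $H^1(S^1)$ with the norm $\|v\|_{H^1_h}^2=\sum_{k\in\mathbb Z}(1+\tfrac{h^2}{6}k^2)|v_k|^2$, and equip $H^1\times H^1_h$ with $\|(u,p)\|^2=\|u\|_{H^1}^2+\|p\|_{H^1_h}^2$. Consider the variational modified equation $$K(u)\,\ddot u-\partial_{xx}u-f(u)-\tfrac{h^2}{12}f''(u)\,\dot u^2=0,\qquad K(u)v=\bigl(1-\tfrac{h^2}{6}f'(u)-\tfrac{h^2}{6}\partial_{xx}\bigr)v .$$ With $L=1-\tfrac{h^2}{6}\partial_{xx}$, $M(u)v=-\tfrac{h^2}{6}f'(u)v$, $p=\dot u$ and $U=(u,p)$ it reads $\dot U=AU+(0,b(U))$, where $$A(u,p)=(p,\,L^{-1}\partial_{xx}u),\qquad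 K(u)\,b(U)=-M(u)L^{-1}\partial_{xx}u+f(u)+\tfrac{h^2}{12}f''(u)\,p^2 ,$$ and $A$ is a bounded operator on $H^1\times H^1_h$. A mild solution on $[0,T]$ with initial datum $U_0$ is a function $U\in C([0,T];H^1\times H^1_h)$ for which there is $\beta\in L^1(0,T;H^1_h)$ such that, for every $t\in[0,T]$, $\beta(t)=b(U(t))$ (that is, $\beta(t)$ is a weak solution of the equation that determines $b(U(t))$) and $$U(t)=e^{tA}U_0+\int_0^t e^{(t-s)A}\bigl(0,\beta(s)\bigr)\,ds .$$ Theorem. For every $C>0$ there are $T>0$, $h_*>0$ and $R>0$, depending only on $C$ (and $f$), such that for every $h\in(0,h_*]$ and every $U_0\in H^1(S^1)\times H^1_h(S^1)$ with $\|U_0\|_{H^1\times H^1_h}\le C$ there is a unique mild solution $U=(u,p)\in C([0,T];H^1(S^1)\times H^1_h(S^1))$ of the variational modified equation with initial datum $U_0$. It satisfies $\|U(t)\|_{H^1\times H^1_h}\le R$ for all $t\in[0,T]$, and for all $t\in[0,T]$ the equation $K(u(t))v=z$ has exactly one weak solution $v\in H^1$ for each $z\in L^2(S^1)$, so that $b(U(t))$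 is well defined. -/

import Mathlib

noncomputable section

namespace ModifiedWave

open MeasureTheory Set
open scoped Real InnerProductSpace ContDiff

instance instTwoPiPos : Fact (0 < 2 * π) := ⟨Real.two_pi_pos⟩

/-- The circle `S¹ = ℝ / 2πℤ`. -/
abbrev Circ : Type := AddCircle (2 * π)

/-- Normalized Lebesgue measure `dx / 2π` on the circle. -/
abbrev circMeas : Measure Circ := AddCircle.haarAddCircle

/-- The real Hilbert space `L²(S¹)`; by Parseval `‖v‖² = ∑ₖ |vₖ|²`. -/
abbrev L2 : Type := Lp ℝ 2 circMeas

/-- The Fourier coefficient `vₖ` of a real-valued function `v`. -/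
def coeff (v : L2) (k : ℤ) : ℂ := fourierCoeff (fun x => ((v x : ℝ) : ℂ)) k

/-- The `k`-th Fourier coefficient as a bounded functional on `L²(S¹)`. -/
def coeffL (k : ℤ) : L2 →L[ℝ] ℂ :=
  ((((innerSL ℂ (fourierBasis (T := 2 * π) k)) :
      Lp ℂ 2 circMeas →L[ℂ] ℂ)).restrictScalars ℝ).comp
    (Complex.ofRealCLM.compLpL 2 circMeas)

theorem coeffL_apply (k : ℤ) (v : L2) : coeffL k v = coeff v k := by
  have h1 : coeffL k v
      = fourierBasis.repr (Complex.ofRealCLM.compLpL 2 circMeas v) k := by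
    rw [HilbertBasis.repr_apply_apply]; rfl
  rw [h1, fourierBasis_repr, coeff]
  exact congrFun (fourierCoeff_congr_ae (Complex.ofRealCLM.coeFn_compLpL v)) k

/-- `g` is the generalized (weak) derivative of `v`: `gₖ = i k vₖ` for all `k`. -/
def IsWeakDeriv (v g : L2) : Prop := ∀ k : ℤ, coeff g k = Complex.I * k * coeff v k

/-- For `a ≠ 0`: the pairs `(v, a ∂ₓv)` with `v ∈ H¹(S¹)`. -/
def h1Graph (a : ℝ) : Submodule ℝ (WithLp 2 (L2 × L2)) where
  carrier := {w | ∀ k : ℤ, coeff w.snd k = a * (Complex.I * k * coeff w.fst k)}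
  add_mem' := by
    intro v w hv hw k
    have hv := hv k
    have hw := hw k
    simp only [← coeffL_apply] at *
    simp only [WithLp.add_snd, WithLp.add_fst, map_add, hv, hw]
    ring
  zero_mem' := by
    intro k
    simp [← coeffL_apply]
  smul_mem' := by
    intro c v hv k
    have hv := hv k
    simp only [← coeffL_apply] at *
    simp only [WithLp.smul_snd, WithLp.smul_fst, map_smul, hv, Complex.real_smul]
    ring

theorem isClosed_h1Graph (a : ℝ) : IsClosed (h1Graph a : Set (WithLp 2 (L2 × L2))) := by
  have : (h1Graph a : Set (WithLp 2 (L2 × L2))) =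
      ⋂ k : ℤ, {w | coeffL k (WithLp.sndL 2 ℝ L2 L2 w)
        = a * (Complex.I * k * coeffL k (WithLp.fstL 2 ℝ L2 L2 w))} := by
    ext w
    simp [h1Graph, coeffL_apply]
  rw [this]
  exact isClosed_iInter fun k => isClosed_eq (by fun_prop) (by fun_prop)

/-- For `a ≠ 0`, the Sobolev space `H¹(S¹)` of real-valued functions with the norm
`‖v‖² = ‖v‖²_{L²} + a² ‖∂ₓv‖²_{L²} = ∑ₖ (1 + a² k²) |vₖ|²`,
an element `v` being stored as the pair `(v, a ∂ₓv)`. -/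
def H1a (a : ℝ) : Type := h1Graph a

instance instNormedH1a (a : ℝ) : NormedAddCommGroup (H1a a) :=
  inferInstanceAs (NormedAddCommGroup (h1Graph a))

instance instInnerH1a (a : ℝ) : InnerProductSpace ℝ (H1a a) :=
  inferInstanceAs (InnerProductSpace ℝ (h1Graph a))

instance instCompleteH1a (a : ℝ) : CompleteSpace (H1a a) :=
  (isClosed_h1Graph a).completeSpace_coe

/-- `H¹(S¹)` with `‖v‖² = ∑ₖ (1 + k²) |vₖ|²`. -/
abbrev H1 : Type := H1a 1

/-- `H¹_h(S¹)`: the space `H¹(S¹)` with `‖v‖² = ∑ₖ (1 + (h²/6) k²) |vₖ|²`. -/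
abbrev H1h (h : ℝ) : Type := H1a (h / √6)

/-- The energy space `H¹ × H¹_h`, with `‖(u, p)‖² = ‖u‖² + ‖p‖²`. -/
abbrev Energy (h : ℝ) : Type := WithLp 2 (H1 × H1h h)

/-- The inclusion `v ↦ (v, a ∂ₓv)` into `L² × L²`. -/
def incl (a : ℝ) : H1a a →L[ℝ] WithLp 2 (L2 × L2) := (h1Graph a).subtypeL

/-- The function underlying an element of `H¹`. -/
def val {a : ℝ} : H1a a →L[ℝ] L2 := (WithLp.fstL 2 ℝ L2 L2).comp (incl a)

/-- The pair entry `a ∂ₓv`. -/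
def scaledDx {a : ℝ} : H1a a →L[ℝ] L2 := (WithLp.sndL 2 ℝ L2 L2).comp (incl a)

/-- The weak derivative `∂ₓv` (for `a ≠ 0`). -/
def dx {a : ℝ} : H1a a →L[ℝ] L2 := a⁻¹ • scaledDx

theorem scale_ne {h : ℝ} (hh : 0 < h) : h / √6 ≠ 0 := by positivity

theorem isWeakDeriv_dx {a : ℝ} (ha : a ≠ 0) (v : H1a a) : IsWeakDeriv (val v) (dx v) := by
  intro k
  have hv : coeff (incl a v).snd k = a * (Complex.I * k * coeff (incl a v).fst k) :=
    Subtype.property (p := (· ∈ h1Graph a)) v k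
  have ha' : (a : ℂ) ≠ 0 := by exact_mod_cast ha
  rw [← coeffL_apply, dx, smul_apply, map_smul, coeffL_apply]
  change a⁻¹ • coeff (incl a v).snd k = _
  rw [hv, Complex.real_smul, Complex.ofReal_inv, inv_mul_cancel_left₀ ha']
  rfl

theorem inner_eq {a : ℝ} (ha : a ≠ 0) (v w : H1a a) :
    ⟪v, w⟫_ℝ = ⟪val v, val w⟫_ℝ + a ^ 2 * ⟪dx v, dx w⟫_ℝ := by
  have h1 : ⟪v, w⟫_ℝ = ⟪val v, val w⟫_ℝ + ⟪scaledDx v, scaledDx w⟫_ℝ := rfl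
  rw [h1, dx, smul_apply, smul_apply,
    real_inner_smul_left, real_inner_smul_right]
  field_simp

/-- The identity `v ↦ v` from `H¹_h` to `H¹`, i.e. `(v, a ∂ₓv) ↦ (v, ∂ₓv)`. -/
def toH1 {a : ℝ} (ha : a ≠ 0) : H1a a →L[ℝ] H1 :=
  ContinuousLinearMap.codRestrict (((WithLp.prodContinuousLinearEquiv 2 ℝ L2 L2).symm : L2 × L2 →L[ℝ] WithLp 2 (L2 × L2)).comp
    (val.prod dx)) (h1Graph 1) (by
      intro v k
      have := isWeakDeriv_dx ha v k
      simpa using this)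

/-- The operator `L⁻¹ ∂ₓₓ : H¹ → H¹_h`, where `L = 1 - (h²/6) ∂ₓₓ`: the function `L⁻¹ ∂ₓₓ u` is the
`q ∈ H¹_h` with `⟪q, φ⟫_{H¹_h} = -⟪∂ₓu, ∂ₓφ⟫_{L²}` for all `φ`
(recall `⟪q, φ⟫_{H¹_h} = ⟪L q, φ⟫_{L²}`). -/
def LinvDxx (h : ℝ) : H1 →L[ℝ] H1h h :=
  -((ContinuousLinearMap.adjoint (dx : H1h h →L[ℝ] L2)).comp dx)

theorem inner_LinvDxx (h : ℝ) (u : H1) (φ : H1h h) :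
    ⟪LinvDxx h u, φ⟫_ℝ = -⟪dx u, dx φ⟫_ℝ := by
  simp [LinvDxx, ContinuousLinearMap.adjoint_inner_left]

/-- The operator `A (u, p) = (p, L⁻¹ ∂ₓₓ u)` on the energy space. -/
def generator {h : ℝ} (hh : 0 < h) : Energy h →L[ℝ] Energy h :=
  ((WithLp.prodContinuousLinearEquiv 2 ℝ H1 (H1h h)).symm :
      H1 × H1h h →L[ℝ] Energy h).comp
    (((toH1 (scale_ne hh)).comp (WithLp.sndL 2 ℝ H1 (H1h h))).prod
      ((LinvDxx h).comp (WithLp.fstL 2 ℝ H1 (H1h h))))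

/-- The exponential `exp(tA)` of a bounded operator `A`. -/
def expOp {E : Type} [NormedAddCommGroup E] [NormedSpace ℝ E] (A : E →L[ℝ] E) (t : ℝ) :
    E →L[ℝ] E :=
  NormedSpace.exp (t • A)

/-- The group `exp(tA)` generated by the operator `A` above. -/
def waveGroup {h : ℝ} (hh : 0 < h) (t : ℝ) : Energy h →L[ℝ] Energy h :=
  expOp (generator hh) t

/-- `K(u) v = z`, where `K(u) v = (1 - (h²/6) f'(u) - (h²/6) ∂ₓₓ) v`, in the weak sense
(for `u ∈ H¹` and `z ∈ L²` such a `v` lies in `H²`). -/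
def SolvesK (f : ℝ → ℝ) (h : ℝ) (u : H1) (z : Circ → ℝ) (v : H1h h) : Prop :=
  ∀ φ : H1,
    (∫ x, val v x * val φ x ∂circMeas)
      - h ^ 2 / 6 * (∫ x, deriv f (val u x) * val v x * val φ x ∂circMeas)
      + h ^ 2 / 6 * (∫ x, dx v x * dx φ x ∂circMeas)
    = ∫ x, z x * val φ x ∂circMeas

/-- `-M(u) L⁻¹ ∂ₓₓ u + f(u) + (h²/12) f''(u) p²`, where `M(u) v = -(h²/6) f'(u) v`. -/
def source (f : ℝ → ℝ) (h : ℝ) (U : Energy h) (x : Circ) : ℝ :=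
  h ^ 2 / 6 * deriv f (val U.fst x) * val (LinvDxx h U.fst) x
    + f (val U.fst x)
    + h ^ 2 / 12 * deriv (deriv f) (val U.fst x) * (val U.snd x) ^ 2

/-- `U ∈ C([0,T]; H¹ × H¹_h)` is a mild solution, with initial datum `U₀`, of the first order system
`u' = p`, `K(u) p' = ∂ₓₓ u + f(u) + (h²/12) f''(u) p²`, which reads `U' = A U + (0, b(U))` with
`b(U) = K(u)⁻¹ (-M(u) L⁻¹ ∂ₓₓ u + f(u) + (h²/12) f''(u) p²)`, since
`K(u)⁻¹ ∂ₓₓ u = L⁻¹ ∂ₓₓ u - K(u)⁻¹ M(u) L⁻¹ ∂ₓₓ u`. Here `β t = b(U(t))`. -/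
def IsMildSolution (f : ℝ → ℝ) {h : ℝ} (hh : 0 < h) (T : ℝ) (U₀ : Energy h)
    (U : ℝ → Energy h) : Prop :=
  ContinuousOn U (Icc 0 T) ∧
  ∃ β : ℝ → H1h h,
    (∀ t ∈ Icc 0 T, SolvesK f h (U t).fst (source f h (U t)) (β t)) ∧
    IntervalIntegrable β volume 0 T ∧
    ∀ t ∈ Icc 0 T,
      U t = waveGroup hh t U₀ + ∫ s in (0 : ℝ)..t, waveGroup hh (t - s) (WithLp.toLp 2 (0, β s))

end ModifiedWave

end

open ModifiedWave
open scoped ContDiff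

/-! The difficulty is uniformity in $h$: the generator $A$ is bounded, but its natural norm bound is
of order $1/h$, and $h^2p^2$ must be controlled although $p$ is bounded only in $H^1_h$. Write
$a=h/\sqrt6$.

The group costs nothing. In $\langle AU,U\rangle$ the derivative terms cancel, since
$L^{-1}\partial_{xx}$ is minus the adjoint of $\partial_x$ composed with $\partial_x$. What remains
is $\langle p,u\rangle_{L^2}\le\frac12\|U\|^2$, so $\|e^{tA}\|\le e^{t/2}$ for every $h$
(`inner_generator_le`, `norm_expOp_le`).

The nonlinearity $b$ is bounded and Lipschitz on balls with constants independent of $h$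
(`exists_bddLipOn_forcing`). By Sobolev embedding, $f(u)$, $f'(u)$, $f''(u)$ are controlled in the
sup norm. The factors $h^2$ pay for the rest: $aL^{-1}\partial_{xx}u$ is bounded in $L^2$, and in
$a^2p^2=a(ap)p$ the factor $ap$ is bounded in $H^1$, hence in the sup norm. Finally
$K(u)=L(1-a^2L^{-1}f'(u))$ is inverted by a Neumann series for small $h$.

Existence is then a contraction on a short time interval. For uniqueness, `norm_lt_of_eq_duhamel`
first confines an arbitrary mild solution to the ball on which these bounds hold. -/

noncomputable section

namespace ModifiedWave

open MeasureTheory Set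
open scoped Real InnerProductSpace ContDiff

/-! ### Abstract semilinear evolution equations in Duhamel form. -/

section Duhamel

variable {E : Type*} [NormedAddCommGroup E] [NormedSpace ℝ E]

/-- The Duhamel integral with initial datum `x₀`, propagator `S` and forcing `γ`. -/
def duhamel (S : ℝ → E →L[ℝ] E) (x₀ : E) (γ : ℝ → E) (t : ℝ) : E :=
  S t x₀ + ∫ s in (0 : ℝ)..t, S (t - s) (γ s)

theorem continuous_duhamel {S : ℝ → E →L[ℝ] E} (hS : Continuous S) (x₀ : E) {γ : ℝ → E}
    (hγ : Continuous γ) : Continuous (duhamel S x₀ γ) := by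
  refine (hS.clm_apply continuous_const).add ?_
  refine intervalIntegral.continuous_parametric_intervalIntegral_of_continuous
    (f := fun t s => S (t - s) (γ s)) ?_ continuous_id
  exact (hS.comp (by fun_prop)).clm_apply (hγ.comp continuous_snd)

theorem norm_propagator_apply_le {S : ℝ → E →L[ℝ] E} {T m : ℝ}
    (hS : ∀ t ∈ Icc 0 T, ‖S t‖ ≤ m) {t : ℝ} (ht : t ∈ Icc 0 T) (x : E) : ‖S t x‖ ≤ m * ‖x‖ :=
  (S t).le_of_opNorm_le (hS t ht) x

theorem norm_duhamel_le {S : ℝ → E →L[ℝ] E} {T m : ℝ} (hS : ∀ t ∈ Icc 0 T, ‖S t‖ ≤ m)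
    (hm : 0 ≤ m) (x₀ : E) {γ : ℝ → E} {B t : ℝ} (hB : 0 ≤ B) (ht : t ∈ Icc 0 T)
    (hγ : ∀ s ∈ Ico 0 t, ‖γ s‖ ≤ B) :
    ‖duhamel S x₀ γ t‖ ≤ m * ‖x₀‖ + m * B * T := by
  have h1 : ‖∫ s in (0 : ℝ)..t, S (t - s) (γ s)‖ ≤ m * B * |t - 0| := by
    refine intervalIntegral.norm_integral_le_of_norm_le_const_ae ?_
    -- The forcing is controlled only before time $t$, so the null set $\{t\}$ is discarded. The
    -- exit-time argument needs the half-open interval.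
    filter_upwards [compl_mem_ae_iff.2 (measure_singleton t)] with s hs hst
    rw [uIoc_of_le ht.1] at hst
    have hne : s < t := lt_of_le_of_ne hst.2 hs
    refine (norm_propagator_apply_le hS
      ⟨by linarith, by linarith [hst.1, ht.2]⟩ _).trans ?_
    gcongr
    exact hγ s ⟨hst.1.le, hne⟩
  rw [sub_zero, abs_of_nonneg ht.1] at h1
  refine (norm_add_le _ _).trans (add_le_add (norm_propagator_apply_le hS ht _) (h1.trans ?_))
  gcongr
  exact ht.2

theorem norm_duhamel_sub_le {S : ℝ → E →L[ℝ] E} (hSc : Continuous S) {T m : ℝ}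
    (hS : ∀ t ∈ Icc 0 T, ‖S t‖ ≤ m) (hm : 0 ≤ m) (x₀ : E) {γ δ : ℝ → E} {B t : ℝ} (hB : 0 ≤ B)
    (ht : t ∈ Icc 0 T) (hγc : ContinuousOn γ (Icc 0 T)) (hδc : ContinuousOn δ (Icc 0 T))
    (h : ∀ s ∈ Icc 0 T, ‖γ s - δ s‖ ≤ B) :
    ‖duhamel S x₀ γ t - duhamel S x₀ δ t‖ ≤ m * B * T := by
  have hint : ∀ η : ℝ → E, ContinuousOn η (Icc 0 T) →
      IntervalIntegrable (fun s => S (t - s) (η s)) volume 0 t := by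
    intro η hη
    refine ContinuousOn.intervalIntegrable ?_
    rw [uIcc_of_le ht.1]
    exact (hSc.comp (by fun_prop)).continuousOn.clm_apply (hη.mono (Icc_subset_Icc_right ht.2))
  have h1 : duhamel S x₀ γ t - duhamel S x₀ δ t
      = duhamel S 0 (fun s => γ s - δ s) t := by
    simp only [duhamel, map_zero, zero_add, map_sub, add_sub_add_left_eq_sub]
    rw [intervalIntegral.integral_sub (hint γ hγc) (hint δ hδc)]
  rw [h1]
  refine (norm_duhamel_le hS hm 0 hB ht fun s hs => h s ⟨hs.1, hs.2.le.trans ht.2⟩).trans ?_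
  simp

/-- Local existence by contraction, for a nonlinearity that is bounded and Lipschitz on a ball. -/
theorem exists_eq_duhamel [CompleteSpace E] {S : ℝ → E →L[ℝ] E} (hSc : Continuous S) {T m : ℝ}
    (hT : 0 ≤ T) (hS : ∀ t ∈ Icc 0 T, ‖S t‖ ≤ m) (hm : 0 ≤ m) {G : E → E} {R B K : ℝ} (hB : 0 ≤ B)
    (hK : 0 ≤ K) (hGB : ∀ x, ‖x‖ ≤ R → ‖G x‖ ≤ B)
    (hGK : ∀ x y, ‖x‖ ≤ R → ‖y‖ ≤ R → ‖G x - G y‖ ≤ K * ‖x - y‖) {x₀ : E}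
    (hR : m * ‖x₀‖ + m * B * T ≤ R) (hKT : m * K * T ≤ 1 / 2) :
    ∃ U : ℝ → E, Continuous U ∧ (∀ t, ‖U t‖ ≤ R) ∧ Continuous (fun t => G (U t)) ∧
      ∀ t ∈ Icc 0 T, U t = duhamel S x₀ (fun s => G (U s)) t := by
  have hR0 : 0 ≤ R := le_trans (by positivity) hR
  let X := C(Icc (0 : ℝ) T, Metric.closedBall (0 : E) R)
  -- Constant extension beyond $[0,T]$ makes the forcing continuous on all of $\mathbb R$.
  let ext : X → ℝ → E := fun u s => u (projIcc 0 T hT s)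
  have hextc : ∀ u, Continuous (ext u) := fun u =>
    continuous_subtype_val.comp (u.continuous.comp continuous_projIcc)
  have hextR : ∀ u s, ‖ext u s‖ ≤ R := fun u s => mem_closedBall_zero_iff.1 (u _).2
  have hGc : ContinuousOn G (Metric.closedBall 0 R) := by
    refine (LipschitzOnWith.of_dist_le_mul (K := ⟨K, hK⟩) fun x hx y hy => ?_).continuousOn
    rw [dist_eq_norm, dist_eq_norm]
    exact hGK x y (mem_closedBall_zero_iff.1 hx) (mem_closedBall_zero_iff.1 hy)
  have hGext : ∀ u, Continuous (fun s => G (ext u s)) := fun u =>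
    hGc.comp_continuous (hextc u) fun s => mem_closedBall_zero_iff.2 (hextR u s)
  let Φ : X → X := fun u =>
    ⟨fun t => ⟨duhamel S x₀ (fun s => G (ext u s)) t, mem_closedBall_zero_iff.2 <|
      (norm_duhamel_le hS hm x₀ hB t.2 fun s _ => hGB _ (hextR u s)).trans hR⟩,
      ((continuous_duhamel hSc x₀ (hGext u)).comp continuous_subtype_val).subtype_mk _⟩
  have hΦ : ContractingWith (1 / 2) Φ := by
    refine ⟨by rw [← NNReal.coe_lt_coe]; norm_num, LipschitzWith.of_dist_le_mul fun u v => ?_⟩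
    refine (ContinuousMap.dist_le (by positivity)).2 fun t => ?_
    rw [Subtype.dist_eq, dist_eq_norm]
    refine (norm_duhamel_sub_le hSc hS hm x₀ (B := K * dist u v) (by positivity) t.2
      (hGext u).continuousOn (hGext v).continuousOn fun s _ => ?_).trans ?_
    · refine (hGK _ _ (hextR u s) (hextR v s)).trans ?_
      gcongr
      rw [← dist_eq_norm]
      exact ContinuousMap.dist_apply_le_dist (f := u) (g := v) (projIcc 0 T hT s)
    · calc m * (K * dist u v) * T = m * K * T * dist u v := by ring
        _ ≤ 1 / 2 * dist u v := by gcongr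
        _ = _ := by norm_num
  have : Nonempty X := ⟨ContinuousMap.const _ ⟨0, by simpa using hR0⟩⟩
  have : CompleteSpace (Metric.closedBall (0 : E) R) :=
    Metric.isClosed_closedBall.completeSpace_coe
  obtain ⟨u, hu⟩ : ∃ u, Φ u = u := ⟨_, hΦ.fixedPoint_isFixedPt⟩
  refine ⟨ext u, hextc u, hextR u, hGext u, fun t ht => ?_⟩
  have h1 := congrArg (fun w : X => ((w ⟨t, ht⟩ : Metric.closedBall (0 : E) R) : E)) hu
  simp only [ext, projIcc_of_mem hT ht]
  exact h1.symm

/-- A solution cannot leave the ball on which the nonlinearity is controlled. -/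
theorem norm_lt_of_eq_duhamel {S : ℝ → E →L[ℝ] E} {T m : ℝ}
    (hS : ∀ t ∈ Icc 0 T, ‖S t‖ ≤ m) (hm : 0 ≤ m) {R B : ℝ} (hB : 0 ≤ B) {x₀ : E}
    (hR : m * ‖x₀‖ + m * B * T < R) {V γ : ℝ → E} (hV : ContinuousOn V (Icc 0 T))
    (hγ : ∀ t ∈ Icc 0 T, ‖V t‖ ≤ R → ‖γ t‖ ≤ B)
    (hVd : ∀ t ∈ Icc 0 T, V t = duhamel S x₀ γ t) : ∀ t ∈ Icc 0 T, ‖V t‖ < R := by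
  by_contra! hne
  obtain ⟨t₁, ht₁, hRt₁⟩ := hne
  have hcl : IsClosed (Icc 0 T ∩ (fun t => ‖V t‖) ⁻¹' Ici R) :=
    hV.norm.preimage_isClosed_of_isClosed isClosed_Icc isClosed_Ici
  have hcpt : IsCompact (Icc 0 T ∩ (fun t => ‖V t‖) ⁻¹' Ici R) :=
    isCompact_Icc.of_isClosed_subset hcl inter_subset_left
  -- Let $t$ be the first time at which the norm reaches $R$. Before $t$ the forcing is at most $B$,
  -- so the Duhamel bound, being strictly below $R$, holds at $t$ as well.
  obtain ⟨t, ⟨ht, htR⟩, hmin⟩ := hcpt.exists_isLeast ⟨t₁, ht₁, hRt₁⟩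
  have hlt : ∀ s ∈ Ico 0 t, ‖γ s‖ ≤ B := by
    intro s hs
    have hsT : s ∈ Icc 0 T := ⟨hs.1, hs.2.le.trans ht.2⟩
    refine hγ s hsT ?_
    by_contra! hc
    exact absurd (hmin ⟨hsT, hc.le⟩) (not_le.2 hs.2)
  have := norm_duhamel_le hS hm x₀ hB ht hlt
  rw [← hVd t ht] at this
  exact absurd htR (not_le.2 (this.trans_lt hR))

/-- No Gronwall argument is needed: where $\|V-U\|$ attains its maximum $d$, the contraction
estimate gives $d\le d/2$. -/
theorem eqOn_of_eq_duhamel {S : ℝ → E →L[ℝ] E} (hSc : Continuous S) {T m : ℝ} (hT : 0 ≤ T)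
    (hS : ∀ t ∈ Icc 0 T, ‖S t‖ ≤ m) (hm : 0 ≤ m) {G : E → E} {R K : ℝ} (hK : 0 ≤ K)
    (hGK : ∀ x y, ‖x‖ ≤ R → ‖y‖ ≤ R → ‖G x - G y‖ ≤ K * ‖x - y‖) {x₀ : E}
    (hKT : m * K * T ≤ 1 / 2) {U V γ δ : ℝ → E}
    (hU : ContinuousOn U (Icc 0 T)) (hV : ContinuousOn V (Icc 0 T))
    (hUR : ∀ t ∈ Icc 0 T, ‖U t‖ ≤ R) (hVR : ∀ t ∈ Icc 0 T, ‖V t‖ ≤ R)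
    (hγ : ∀ t ∈ Icc 0 T, γ t = G (U t)) (hδ : ∀ t ∈ Icc 0 T, δ t = G (V t))
    (hUd : ∀ t ∈ Icc 0 T, U t = duhamel S x₀ γ t)
    (hVd : ∀ t ∈ Icc 0 T, V t = duhamel S x₀ δ t) : EqOn V U (Icc 0 T) := by
  have hGc : ContinuousOn G (Metric.closedBall 0 R) := by
    refine (LipschitzOnWith.of_dist_le_mul (K := ⟨K, hK⟩) fun x hx y hy => ?_).continuousOn
    rw [dist_eq_norm, dist_eq_norm]
    exact hGK x y (mem_closedBall_zero_iff.1 hx) (mem_closedBall_zero_iff.1 hy)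
  have hγc : ContinuousOn γ (Icc 0 T) :=
    (hGc.comp hU fun t ht => mem_closedBall_zero_iff.2 (hUR t ht)).congr hγ
  have hδc : ContinuousOn δ (Icc 0 T) :=
    (hGc.comp hV fun t ht => mem_closedBall_zero_iff.2 (hVR t ht)).congr hδ
  obtain ⟨t, ht, hmax⟩ := isCompact_Icc.exists_isMaxOn (nonempty_Icc.2 hT) (hV.sub hU).norm
  have h1 : ‖V t - U t‖ ≤ m * (K * ‖V t - U t‖) * T := by
    conv_lhs => rw [hVd t ht, hUd t ht]
    refine norm_duhamel_sub_le hSc hS hm x₀ (by positivity) ht hδc hγc fun s hs => ?_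
    rw [hγ s hs, hδ s hs]
    refine (hGK _ _ (hVR s hs) (hUR s hs)).trans ?_
    gcongr
    exact hmax hs
  have h2 : ‖V t - U t‖ ≤ 0 := by nlinarith [norm_nonneg (V t - U t)]
  intro s hs
  exact sub_eq_zero.1 (norm_le_zero_iff.1 ((hmax hs).trans h2))

end Duhamel

/-- `‖exp(tA)‖ ≤ exp(ct)` if `⟪A x, x⟫ ≤ c ‖x‖²`. -/
theorem norm_expOp_le {E : Type} [NormedAddCommGroup E] [InnerProductSpace ℝ E] [CompleteSpace E]
    (A : E →L[ℝ] E) {c : ℝ} (hA : ∀ x, ⟪A x, x⟫_ℝ ≤ c * ‖x‖ ^ 2) {t : ℝ} (ht : 0 ≤ t) :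
    ‖expOp A t‖ ≤ Real.exp (c * t) := by
  refine ContinuousLinearMap.opNorm_le_bound _ (Real.exp_pos _).le fun x => ?_
  have hd : ∀ s, HasDerivAt (fun s => expOp A s x) (A (expOp A s x)) s := by
    intro s
    have h1 := (hasDerivAt_exp_smul_const' A s).clm_apply (hasDerivAt_const s x)
    simpa [expOp] using h1
  -- With $y=e^{sA}x$ the derivative is $2e^{-2cs}(\langle Ay,y\rangle-c\|y\|^2)\le0$.
  let φ : ℝ → ℝ := fun s => Real.exp (-2 * c * s) * ‖expOp A s x‖ ^ 2
  have hφ : ∀ s, HasDerivAt φ (Real.exp (-2 * c * s) * (-2 * c) * ‖expOp A s x‖ ^ 2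
      + Real.exp (-2 * c * s) * (2 * ⟪expOp A s x, A (expOp A s x)⟫_ℝ)) s := by
    intro s
    have h1 : HasDerivAt (fun s : ℝ => -2 * c * s) (-2 * c) s := by
      simpa using (hasDerivAt_id s).const_mul (-2 * c)
    exact h1.exp.mul (hd s).norm_sq
  have hanti : Antitone φ := by
    refine antitone_of_deriv_nonpos (fun s => (hφ s).differentiableAt) fun s => ?_
    rw [(hφ s).deriv]
    have h1 := hA (expOp A s x)
    rw [real_inner_comm] at h1
    nlinarith [Real.exp_pos (-2 * c * s)]
  have h0 : expOp A 0 x = x := by simp [expOp]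
  have h1 : Real.exp (-2 * c * t) * ‖expOp A t x‖ ^ 2 ≤ ‖x‖ ^ 2 := by
    simpa [φ, h0] using hanti ht
  have h2 : Real.exp (-2 * c * t) * Real.exp (c * t) ^ 2 = 1 := by
    rw [← Real.exp_nat_mul, ← Real.exp_add]
    simp only [Nat.cast_ofNat]
    ring_nf
    exact Real.exp_zero
  refine abs_le_of_sq_le_sq' ?_ (by positivity) |>.2
  calc ‖expOp A t x‖ ^ 2
      = (Real.exp (-2 * c * t) * ‖expOp A t x‖ ^ 2) * Real.exp (c * t) ^ 2 := by
        linear_combination (-‖expOp A t x‖ ^ 2) * h2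
    _ ≤ ‖x‖ ^ 2 * Real.exp (c * t) ^ 2 := by gcongr
    _ = (Real.exp (c * t) * ‖x‖) ^ 2 := by ring

theorem continuous_expOp {E : Type} [NormedAddCommGroup E] [NormedSpace ℝ E] [CompleteSpace E]
    (A : E →L[ℝ] E) : Continuous (expOp A) :=
  continuous_iff_continuousAt.2 fun t => (hasDerivAt_exp_smul_const A t).continuousAt

/-! ### The spaces $H^1$ and $H^1_h$, and the embedding into continuous functions. -/

section Sobolev

theorem norm_sq_eq {a : ℝ} (v : H1a a) : ‖v‖ ^ 2 = ‖val v‖ ^ 2 + ‖scaledDx v‖ ^ 2 := by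
  have h1 : ⟪v, v⟫_ℝ = ⟪val v, val v⟫_ℝ + ⟪scaledDx v, scaledDx v⟫_ℝ := rfl
  simpa only [real_inner_self_eq_norm_sq] using h1

theorem norm_val_le {a : ℝ} (v : H1a a) : ‖val v‖ ≤ ‖v‖ :=
  (sq_le_sq₀ (norm_nonneg _) (norm_nonneg _)).1 (by
    rw [norm_sq_eq v]; linarith [sq_nonneg ‖scaledDx v‖])

theorem norm_scaledDx_le {a : ℝ} (v : H1a a) : ‖scaledDx v‖ ≤ ‖v‖ :=
  (sq_le_sq₀ (norm_nonneg _) (norm_nonneg _)).1 (by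
    rw [norm_sq_eq v]; linarith [sq_nonneg ‖val v‖])

theorem smul_dx {a : ℝ} (ha : a ≠ 0) (v : H1a a) : a • dx v = scaledDx v := by
  rw [dx, smul_apply, smul_inv_smul₀ ha]

theorem dx_eq_scaledDx (v : H1) : dx v = scaledDx v := by
  simpa using smul_dx one_ne_zero v

theorem norm_dx_le {a : ℝ} (ha : 0 < a) (v : H1a a) : ‖dx v‖ ≤ a⁻¹ * ‖v‖ := by
  rw [dx, smul_apply, norm_smul, norm_inv, Real.norm_of_nonneg ha.le]
  gcongr
  exact norm_scaledDx_le v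

@[simp]
theorem val_toH1 {a : ℝ} (ha : a ≠ 0) (v : H1a a) : val (toH1 ha v) = val v := rfl

@[simp]
theorem dx_toH1 {a : ℝ} (ha : a ≠ 0) (v : H1a a) : dx (toH1 ha v) = dx v := by
  rw [dx_eq_scaledDx]; rfl

theorem H1a.ext {a : ℝ} {v w : H1a a} (h1 : val v = val w) (h2 : scaledDx v = scaledDx w) :
    v = w := by
  refine Subtype.ext ?_
  exact (WithLp.ofLp_injective 2) (Prod.ext h1 h2)

/-- Allows test functions in $H^1$ to be replaced by test functions in $H^1_h$, where Riesz duality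
applies. -/
theorem toH1_surjective {a : ℝ} (ha : a ≠ 0) : Function.Surjective (toH1 ha) := by
  intro φ
  have hmem : WithLp.toLp 2 (val φ, a • dx φ) ∈ h1Graph a := by
    intro k
    have h1 := isWeakDeriv_dx one_ne_zero φ k
    change coeff (a • dx φ) k = a * (Complex.I * k * coeff (val φ) k)
    rw [← h1, ← coeffL_apply, ← coeffL_apply, map_smul, Complex.real_smul]
  refine ⟨(⟨_, hmem⟩ : h1Graph a), H1a.ext rfl ?_⟩
  change a⁻¹ • a • dx φ = _
  rw [inv_smul_smul₀ ha, dx_eq_scaledDx]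

/-- Passing from $H^1_h$ to $H^1$ costs one factor $1/a$, which the quadratic term can afford. -/
theorem norm_smul_toH1_le {a : ℝ} (ha : 0 < a) (ha1 : a ≤ 1) (v : H1a a) :
    ‖a • toH1 ha.ne' v‖ ≤ ‖v‖ := by
  refine (sq_le_sq₀ (norm_nonneg _) (norm_nonneg _)).1 ?_
  rw [norm_sq_eq v, ← smul_dx ha.ne' v, norm_smul, norm_smul, mul_pow, mul_pow,
    norm_sq_eq (toH1 ha.ne' v), ← dx_eq_scaledDx, dx_toH1, val_toH1, Real.norm_of_nonneg ha.le]
  nlinarith [mul_le_mul_of_nonneg_right (pow_le_one₀ ha.le ha1 : a ^ 2 ≤ 1) (sq_nonneg ‖val v‖)]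

/-- The complex-valued copy of a real-valued `L²` function. -/
def complexify : L2 →L[ℝ] Lp ℂ 2 circMeas := Complex.ofRealCLM.compLpL 2 circMeas

theorem norm_complexify_le (v : L2) : ‖complexify v‖ ≤ ‖v‖ := by
  have := Complex.ofRealCLM.norm_compLp_le v
  rwa [Complex.ofRealCLM_norm, one_mul] at this

theorem sum_sq_coeff_le (v : L2) (s : Finset ℤ) : ∑ k ∈ s, ‖coeff v k‖ ^ 2 ≤ ‖v‖ ^ 2 := by
  have h1 := (fourierBasis (T := 2 * π)).orthonormal.sum_inner_products_le (complexify v) (s := s)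
  refine le_trans (le_of_eq ?_) (h1.trans (by gcongr; exact norm_complexify_le v))
  refine Finset.sum_congr rfl fun k _ => ?_
  rw [← coeffL_apply]
  rfl

theorem summable_inv_one_add_sq : Summable fun k : ℤ => (1 + (k : ℝ) ^ 2)⁻¹ := by
  refine Summable.of_norm_bounded_eventually
    (g := fun k : ℤ => 1 / (k : ℝ) ^ 2) (Real.summable_one_div_int_pow.2 one_lt_two) ?_
  filter_upwards [(finite_singleton (0 : ℤ)).compl_mem_cofinite] with k hk
  have hk' : (k : ℝ) ≠ 0 := by exact_mod_cast hk
  rw [norm_inv, Real.norm_of_nonneg (by positivity), one_div]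
  gcongr
  linarith

/-- The constant of the embedding of `H¹(S¹)` into the continuous functions. -/
def sobolevConst : ℝ := √(∑' k : ℤ, (1 + (k : ℝ) ^ 2)⁻¹)

theorem sobolevConst_nonneg : 0 ≤ sobolevConst := Real.sqrt_nonneg _

/-- Cauchy–Schwarz with the weights $(1+k^2)^{\mp1/2}$. -/
theorem sum_norm_coeff_le (v : H1) (s : Finset ℤ) :
    ∑ k ∈ s, ‖coeff (val v) k‖ ≤ sobolevConst * ‖v‖ := by
  have h1 := Finset.sum_mul_sq_le_sq_mul_sq s (fun k : ℤ => √((1 + (k : ℝ) ^ 2)⁻¹))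
    (fun k => √(1 + (k : ℝ) ^ 2) * ‖coeff (val v) k‖)
  have h2 : ∀ k : ℤ, √((1 + (k : ℝ) ^ 2)⁻¹) * (√(1 + (k : ℝ) ^ 2) * ‖coeff (val v) k‖)
      = ‖coeff (val v) k‖ := by
    intro k
    rw [Real.sqrt_inv, inv_mul_cancel_left₀ (by positivity)]
  have h3 : ∀ k : ℤ, (√(1 + (k : ℝ) ^ 2) * ‖coeff (val v) k‖) ^ 2
      = ‖coeff (val v) k‖ ^ 2 + ‖coeff (dx v) k‖ ^ 2 := by
    intro k
    rw [isWeakDeriv_dx one_ne_zero v k, mul_pow, Real.sq_sqrt (by positivity), norm_mul, norm_mul,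
      Complex.norm_I, Complex.norm_intCast, one_mul, mul_pow, sq_abs]
    ring
  simp only [h2, h3, Finset.sum_add_distrib] at h1
  have h4 : ∑ k ∈ s, √((1 + (k : ℝ) ^ 2)⁻¹) ^ 2 ≤ sobolevConst ^ 2 := by
    rw [sobolevConst, Real.sq_sqrt (tsum_nonneg fun k => by positivity)]
    refine le_trans (le_of_eq ?_)
      (summable_inv_one_add_sq.sum_le_tsum s fun k _ => by positivity)
    exact Finset.sum_congr rfl fun k _ => Real.sq_sqrt (by positivity)
  refine abs_le_of_sq_le_sq' ?_ (mul_nonneg sobolevConst_nonneg (norm_nonneg v)) |>.2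
  refine h1.trans ?_
  rw [mul_pow, norm_sq_eq v, ← dx_eq_scaledDx]
  gcongr
  · exact sum_sq_coeff_le _ s
  · exact sum_sq_coeff_le _ s

/-- The Fourier series converges absolutely, hence uniformly, and its sum agrees with $v$ in $L^2$.
The real part is taken because the series is complex-valued. -/
theorem exists_continuousMap_ae_eq (v : H1) :
    ∃ g : C(Circ, ℝ), g =ᵐ[circMeas] val v ∧ ‖g‖ ≤ sobolevConst * ‖v‖ := by
  have hnorm : ∀ k : ℤ, ‖coeff (val v) k • fourier (T := 2 * π) k‖ = ‖coeff (val v) k‖ := by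
    intro k
    rw [norm_smul, fourier_norm, mul_one]
  have hs : Summable fun k : ℤ => ‖coeff (val v) k‖ :=
    summable_of_sum_le (fun k => norm_nonneg _) (sum_norm_coeff_le v)
  have hs' : Summable fun k : ℤ => coeff (val v) k • fourier (T := 2 * π) k :=
    Summable.of_norm (by simpa only [hnorm] using hs)
  set F : C(Circ, ℂ) := ∑' k : ℤ, coeff (val v) k • fourier k with hF
  have hFn : ‖F‖ ≤ sobolevConst * ‖v‖ := by
    refine (norm_tsum_le_tsum_norm (by simpa only [hnorm] using hs)).trans ?_
    simp only [hnorm]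
    exact hs.tsum_le_of_sum_le (sum_norm_coeff_le v)
  have h1 : HasSum (fun k : ℤ => coeff (val v) k • fourierLp (T := 2 * π) 2 k)
      (ContinuousMap.toLp 2 circMeas ℂ F) := by
    have := (ContinuousMap.toLp (E := ℂ) 2 circMeas ℂ).hasSum hs'.hasSum
    simpa only [Function.comp_def, map_smul] using this
  have h2 := hasSum_fourier_series_L2 (complexify (val v))
  have hae := Complex.ofRealCLM.coeFn_compLpL (p := 2) (μ := circMeas) (val v)
  have h3 : ∀ k : ℤ, fourierCoeff (complexify (val v)) k = coeff (val v) k := fun k =>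
    congrFun (fourierCoeff_congr_ae hae) k
  simp only [h3] at h2
  have h4 := h1.unique h2
  refine ⟨⟨fun x => (F x).re, by fun_prop⟩, ?_, ?_⟩
  · filter_upwards [ContinuousMap.coeFn_toLp (𝕜 := ℂ) (p := 2) circMeas F, hae] with x hx1 hx2
    rw [h4] at hx1
    change (F x).re = _
    rw [← hx1]
    change ((Complex.ofRealCLM.compLpL 2 circMeas (val v)) x).re = _
    rw [hx2]
    simp
  · refine (ContinuousMap.norm_le _ ((norm_nonneg _).trans hFn)).2 fun x => ?_
    exact (Complex.abs_re_le_norm _).trans ((F.norm_coe_le_norm x).trans hFn)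

theorem continuousMap_eq_of_ae_eq {g k : C(Circ, ℝ)} (h : g =ᵐ[circMeas] k) : g = k :=
  DFunLike.coe_injective ((Continuous.ae_eq_iff_eq circMeas g.continuous k.continuous).1 h)

/-- The embedding of `H¹(S¹)` into the continuous functions. -/
def contRep : H1 →L[ℝ] C(Circ, ℝ) :=
  LinearMap.mkContinuous
    { toFun := fun v => (exists_continuousMap_ae_eq v).choose
      map_add' := fun v w => continuousMap_eq_of_ae_eq <| by
        filter_upwards [(exists_continuousMap_ae_eq v).choose_spec.1,
          (exists_continuousMap_ae_eq w).choose_spec.1,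
          (exists_continuousMap_ae_eq (v + w)).choose_spec.1,
          Lp.coeFn_add (val v) (val w)] with x h1 h2 h3 h4
        rw [h3, map_add, h4, ContinuousMap.add_apply, Pi.add_apply, h1, h2]
      map_smul' := fun c v => continuousMap_eq_of_ae_eq <| by
        filter_upwards [(exists_continuousMap_ae_eq v).choose_spec.1,
          (exists_continuousMap_ae_eq (c • v)).choose_spec.1,
          Lp.coeFn_smul c (val v)] with x h1 h2 h3
        rw [h2, map_smul, h3, RingHom.id_apply, ContinuousMap.smul_apply, Pi.smul_apply, h1] }
    sobolevConst fun v => (exists_continuousMap_ae_eq v).choose_spec.2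

theorem contRep_ae_eq (v : H1) : contRep v =ᵐ[circMeas] val v :=
  (exists_continuousMap_ae_eq v).choose_spec.1

theorem norm_contRep_le (v : H1) : ‖contRep v‖ ≤ sobolevConst * ‖v‖ :=
  (exists_continuousMap_ae_eq v).choose_spec.2

end Sobolev

/-! ### Bounds for the wave group, uniform in $h$. -/

section Generator

/-- The derivative $H^1_h\to L^2$ has norm at most $1/a$, hence so does its adjoint. -/
theorem norm_smul_LinvDxx_le {h : ℝ} (hh : 0 < h) (u : H1) :
    ‖(h / √6) • LinvDxx h u‖ ≤ ‖u‖ := by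
  have ha : 0 < h / √6 := by positivity
  have h1 : ‖(dx : H1h h →L[ℝ] L2)‖ ≤ (h / √6)⁻¹ :=
    ContinuousLinearMap.opNorm_le_bound _ (by positivity) (norm_dx_le ha)
  have h2 : ‖LinvDxx h u‖ ≤ (h / √6)⁻¹ * ‖u‖ := by
    rw [LinvDxx, neg_apply, norm_neg, ContinuousLinearMap.comp_apply]
    refine (ContinuousLinearMap.le_of_opNorm_le _ (c := (h / √6)⁻¹) ?_ _).trans ?_
    · rwa [LinearIsometryEquiv.norm_map]
    · gcongr
      rw [dx_eq_scaledDx]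
      exact norm_scaledDx_le u
  rw [norm_smul, Real.norm_of_nonneg ha.le]
  calc h / √6 * ‖LinvDxx h u‖ ≤ h / √6 * ((h / √6)⁻¹ * ‖u‖) := by gcongr
    _ = ‖u‖ := mul_inv_cancel_left₀ ha.ne' _

/-- The terms $\pm\langle\partial_xu,\partial_xp\rangle$ cancel, so the constant does not depend on
$h$. -/
theorem inner_generator_le {h : ℝ} (hh : 0 < h) (U : Energy h) :
    ⟪generator hh U, U⟫_ℝ ≤ 1 / 2 * ‖U‖ ^ 2 := by
  have h1 : ⟪generator hh U, U⟫_ℝ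
      = ⟪toH1 (scale_ne hh) U.snd, U.fst⟫_ℝ + ⟪LinvDxx h U.fst, U.snd⟫_ℝ := by
    rw [WithLp.prod_inner_apply]; rfl
  rw [h1, inner_LinvDxx, inner_eq one_ne_zero, val_toH1, dx_toH1, real_inner_comm (dx U.fst),
    WithLp.prod_norm_sq_eq_of_L2]
  have h2 := real_inner_le_norm (val U.snd) (val U.fst)
  have h3 := norm_val_le U.fst
  have h4 := norm_val_le U.snd
  nlinarith [sq_nonneg (‖U.fst‖ - ‖U.snd‖), norm_nonneg (val U.snd), norm_nonneg (val U.fst),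
    mul_le_mul h4 h3 (norm_nonneg _) (norm_nonneg _)]

theorem norm_waveGroup_le {h : ℝ} (hh : 0 < h) {t : ℝ} (ht : t ∈ Icc (0 : ℝ) 1) :
    ‖waveGroup hh t‖ ≤ 2 := by
  refine (norm_expOp_le (generator hh) (inner_generator_le hh) ht.1).trans ?_
  have h1 : Real.exp (1 / 2 * t) ^ 2 ≤ 2 ^ 2 := by
    rw [← Real.exp_nat_mul]
    calc Real.exp ((2 : ℕ) * (1 / 2 * t)) ≤ Real.exp 1 :=
          Real.exp_le_exp.2 (by push_cast; linarith [ht.2])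
      _ ≤ 2 ^ 2 := by linarith [Real.exp_one_lt_d9]
  exact (sq_le_sq₀ (Real.exp_pos _).le (by norm_num)).1 h1

end Generator

/-! ### Calculus of bounded Lipschitz maps with explicit constants. -/

section BoundedLipschitz

variable {X Y Z W : Type*} [NormedAddCommGroup X] [NormedAddCommGroup Y] [NormedAddCommGroup Z]
  [NormedAddCommGroup W]

/-- On the ball of radius `R`, the map `F` is bounded by `B` and Lipschitz with constant `K`. -/
def BddLipOn (R : ℝ) (F : X → Y) (B K : ℝ) : Prop :=
  (∀ x, ‖x‖ ≤ R → ‖F x‖ ≤ B) ∧ ∀ x y, ‖x‖ ≤ R → ‖y‖ ≤ R → ‖F x - F y‖ ≤ K * ‖x - y‖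

namespace BddLipOn

variable {R B K B' K' : ℝ}

theorem nonneg_left {F : X → Y} (hF : BddLipOn R F B K) (hR : 0 ≤ R) : 0 ≤ B :=
  (norm_nonneg _).trans (hF.1 0 (by simpa using hR))

theorem add {F G : X → Y} (hF : BddLipOn R F B K) (hG : BddLipOn R G B' K') :
    BddLipOn R (fun x => F x + G x) (B + B') (K + K') := by
  refine ⟨fun x hx => norm_add_le_of_le (hF.1 x hx) (hG.1 x hx), fun x y hx hy => ?_⟩
  rw [add_sub_add_comm, add_mul]
  exact norm_add_le_of_le (hF.2 x y hx hy) (hG.2 x y hx hy)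

theorem comp {F : X → Y} {G : Y → Z} (hG : BddLipOn B G B' K') (hF : BddLipOn R F B K)
    (hK' : 0 ≤ K') : BddLipOn R (fun x => G (F x)) B' (K' * K) := by
  refine ⟨fun x hx => hG.1 _ (hF.1 x hx), fun x y hx hy => ?_⟩
  refine (hG.2 _ _ (hF.1 x hx) (hF.1 y hy)).trans ?_
  rw [mul_assoc]
  exact mul_le_mul_of_nonneg_left (hF.2 x y hx hy) hK'

variable [NormedSpace ℝ Y] [NormedSpace ℝ Z] [NormedSpace ℝ W]

theorem of_linear [NormedSpace ℝ X] (L : X →L[ℝ] Y) (hK : 0 ≤ K) (hL : ∀ x, ‖L x‖ ≤ K * ‖x‖) :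
    BddLipOn R L (K * R) K :=
  ⟨fun x hx => (hL x).trans (by gcongr), fun x y _ _ => by rw [← map_sub]; exact hL _⟩

theorem linear_comp {F : X → Y} (hF : BddLipOn R F B K) (L : Y →L[ℝ] Z)
    (hL : ∀ y, ‖L y‖ ≤ ‖y‖) : BddLipOn R (fun x => L (F x)) B K :=
  ⟨fun x hx => (hL _).trans (hF.1 x hx), fun x y hx hy => by
    rw [← map_sub]; exact (hL _).trans (hF.2 x y hx hy)⟩

theorem smul {F : X → Y} (hF : BddLipOn R F B K) {c : ℝ} (hc : |c| ≤ 1) :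
    BddLipOn R (fun x => c • F x) B K :=
  hF.linear_comp (c • ContinuousLinearMap.id ℝ Y) fun y => by
    rw [smul_apply, norm_smul]
    exact mul_le_of_le_one_left (norm_nonneg _) hc

theorem bilin {F : X → Y} {G : X → Z} (hF : BddLipOn R F B K) (hG : BddLipOn R G B' K')
    (hR : 0 ≤ R) (m : Y →L[ℝ] Z →L[ℝ] W) (hm : ∀ y z, ‖m y z‖ ≤ ‖y‖ * ‖z‖) :
    BddLipOn R (fun x => m (F x) (G x)) (B * B') (K * B' + B * K') := by
  have hB := hF.nonneg_left hR
  refine ⟨fun x hx => (hm _ _).trans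
    (mul_le_mul (hF.1 x hx) (hG.1 x hx) (norm_nonneg _) hB), fun x y hx hy => ?_⟩
  have h1 : m (F x) (G x) - m (F y) (G y) = m (F x - F y) (G x) + m (F y) (G x - G y) := by
    simp only [map_sub, sub_apply]
    abel
  have h2 := hF.2 x y hx hy
  rw [h1]
  calc ‖m (F x - F y) (G x) + m (F y) (G x - G y)‖
      ≤ ‖F x - F y‖ * ‖G x‖ + ‖F y‖ * ‖G x - G y‖ :=
        norm_add_le_of_le (hm _ _) (hm _ _)
    _ ≤ (K * ‖x - y‖) * B' + B * (K' * ‖x - y‖) := by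
        gcongr
        · exact (norm_nonneg _).trans h2
        · exact hG.1 x hx
        · exact hF.1 y hy
        · exact hG.2 x y hx hy
    _ = (K * B' + B * K') * ‖x - y‖ := by ring

/-- In $b=w+Pb$ with $\|P\|\le\frac12$ the last term is absorbed on the left, at the price of a
factor 2. For differences, $(P_x-P_y)b_y$ adds $K\cdot2B$ to the Lipschitz constant. -/
theorem of_sub_eq {P : X → Y →L[ℝ] Y} {w b : X → Y} (hP : BddLipOn R P (1 / 2) K)
    (hw : BddLipOn R w B K') (hK : 0 ≤ K)
    (hb : ∀ x, ‖x‖ ≤ R → b x - P x (b x) = w x) :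
    BddLipOn R b (2 * B) (2 * (K' + K * (2 * B))) := by
  have hbd : ∀ x, ‖x‖ ≤ R → ‖b x‖ ≤ 2 * B := by
    intro x hx
    have h1 := (P x).le_of_opNorm_le (hP.1 x hx) (b x)
    have h2 : ‖b x‖ ≤ ‖w x‖ + ‖P x (b x)‖ := by
      rw [← hb x hx]
      exact norm_le_norm_sub_add _ _
    linarith [hw.1 x hx]
  refine ⟨hbd, fun x y hx hy => ?_⟩
  have h1 := (P x).le_of_opNorm_le (hP.1 x hx) (b x - b y)
  have h2 : b x - b y = (w x - w y) + (P x - P y) (b y) + P x (b x - b y) := by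
    rw [← hb x hx, ← hb y hy, sub_apply, map_sub]
    abel
  have h3 : ‖b x - b y‖ ≤ ‖w x - w y‖ + ‖(P x - P y) (b y)‖ + ‖P x (b x - b y)‖ := by
    conv_lhs => rw [h2]
    exact norm_add₃_le
  have h4 : ‖(P x - P y) (b y)‖ ≤ K * ‖x - y‖ * (2 * B) :=
    ((P x - P y).le_opNorm (b y)).trans
      (mul_le_mul (hP.2 x y hx hy) (hbd y hy) (norm_nonneg _) (by positivity))
  linarith [hw.2 x y hx hy]

end BddLipOn

theorem exists_bddLipOn_real {F : ℝ → ℝ} (hF : ContDiff ℝ 1 F) (r : ℝ) :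
    ∃ B K : ℝ, 0 ≤ B ∧ 0 ≤ K ∧ BddLipOn r F B K := by
  have hcpt : IsCompact (Metric.closedBall (0 : ℝ) r) := isCompact_closedBall _ _
  obtain ⟨B, hB⟩ := hcpt.exists_bound_of_continuousOn hF.continuous.continuousOn
  obtain ⟨K, hK⟩ := hcpt.exists_bound_of_continuousOn
    (hF.continuous_deriv le_rfl).continuousOn
  refine ⟨|B|, |K|, abs_nonneg _, abs_nonneg _, fun x hx => ?_, fun x y hx hy => ?_⟩
  · exact (hB x (mem_closedBall_zero_iff.2 hx)).trans (le_abs_self _)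
  · exact (convex_closedBall (0 : ℝ) r).norm_image_sub_le_of_norm_deriv_le
      (fun z _ => (hF.differentiable one_ne_zero).differentiableAt)
      (fun z hz => (hK z hz).trans (le_abs_self _))
      (mem_closedBall_zero_iff.2 hy) (mem_closedBall_zero_iff.2 hx)

/-- The superposition operator `g ↦ F ∘ g`. -/
def superpose {F : ℝ → ℝ} (hF : Continuous F) (g : C(Circ, ℝ)) : C(Circ, ℝ) :=
  (⟨F, hF⟩ : C(ℝ, ℝ)).comp g

theorem BddLipOn.superpose {F : ℝ → ℝ} {r B K : ℝ} (h : BddLipOn r F B K) (hB : 0 ≤ B)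
    (hK : 0 ≤ K) (hF : Continuous F) : BddLipOn r (superpose hF) B K := by
  refine ⟨fun g hg => (ContinuousMap.norm_le _ hB).2 fun x =>
    h.1 _ ((g.norm_coe_le_norm x).trans hg), fun g k hg hk => ?_⟩
  refine (ContinuousMap.norm_le _ (by positivity)).2 fun x => ?_
  refine (h.2 _ _ ((g.norm_coe_le_norm x).trans hg) ((k.norm_coe_le_norm x).trans hk)).trans ?_
  gcongr
  exact (g - k).norm_coe_le_norm x

end BoundedLipschitz

/-! ### Multiplication operators on $L^2$. -/

section Multiplication

/-- Multiplication of `L²` functions by continuous functions. -/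
def mulL2 : C(Circ, ℝ) →L[ℝ] L2 →L[ℝ] L2 :=
  ((ContinuousLinearMap.mul ℝ ℝ).holderL circMeas ⊤ 2 2).comp
    (ContinuousMap.toLp ⊤ circMeas ℝ)

theorem mulL2_ae_eq (g : C(Circ, ℝ)) (v : L2) :
    mulL2 g v =ᵐ[circMeas] fun x => g x * v x := by
  have h1 := (ContinuousLinearMap.mul ℝ ℝ).coeFn_holder (r := 2)
    (ContinuousMap.toLp ⊤ circMeas ℝ g) v
  filter_upwards [h1, ContinuousMap.coeFn_toLp (𝕜 := ℝ) (p := ⊤) circMeas g] with x hx1 hx2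
  rw [← hx2]
  exact hx1

theorem norm_mulL2_le (g : C(Circ, ℝ)) (v : L2) : ‖mulL2 g v‖ ≤ ‖g‖ * ‖v‖ := by
  have h1 := (ContinuousLinearMap.mul ℝ ℝ).norm_holder_apply_apply_le (r := 2)
    (ContinuousMap.toLp ⊤ circMeas ℝ g) v
  have h2 : ‖ContinuousMap.toLp ⊤ circMeas ℝ g‖ ≤ ‖g‖ := by
    refine (ContinuousLinearMap.le_of_opNorm_le _ (ContinuousMap.toLp_norm_le circMeas) g).trans ?_
    simp
  refine h1.trans ?_
  rw [ContinuousLinearMap.opNorm_mul, one_mul]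
  gcongr

/-- The inclusion of the continuous functions into `L²`. -/
def contToL2 : C(Circ, ℝ) →L[ℝ] L2 := ContinuousMap.toLp 2 circMeas ℝ

theorem contToL2_ae_eq (g : C(Circ, ℝ)) : contToL2 g =ᵐ[circMeas] g :=
  ContinuousMap.coeFn_toLp (𝕜 := ℝ) (p := 2) circMeas g

theorem norm_contToL2_le (g : C(Circ, ℝ)) : ‖contToL2 g‖ ≤ ‖g‖ := by
  refine (ContinuousLinearMap.le_of_opNorm_le _
    (ContinuousMap.toLp_norm_le (p := 2) circMeas) g).trans ?_
  simp [measureUnivNNReal]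

end Multiplication

/-! ### Inversion of $K(u)$ in the weak sense. -/

section WeakSolution

/-- The operator `L⁻¹ : L² → H¹_h`, given by `⟪L⁻¹ z, φ⟫_{H¹_h} = ⟪z, φ⟫_{L²}`. -/
def Linv (h : ℝ) : L2 →L[ℝ] H1h h := ContinuousLinearMap.adjoint val

theorem inner_Linv (h : ℝ) (z : L2) (φ : H1h h) : ⟪Linv h z, φ⟫_ℝ = ⟪z, val φ⟫_ℝ :=
  ContinuousLinearMap.adjoint_inner_left _ _ _

theorem norm_Linv_le (h : ℝ) (z : L2) : ‖Linv h z‖ ≤ ‖z‖ := by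
  have h1 : ‖(val : H1h h →L[ℝ] L2)‖ ≤ 1 :=
    ContinuousLinearMap.opNorm_le_bound _ zero_le_one fun v => by
      rw [one_mul]; exact norm_val_le v
  simpa using ContinuousLinearMap.le_of_opNorm_le (Linv h) (c := 1)
    (by rwa [Linv, LinearIsometryEquiv.norm_map]) z

/-- The operator `v ↦ (h²/6) L⁻¹ (g v)`, as a function of `g`. -/
def pert (h : ℝ) : C(Circ, ℝ) →L[ℝ] H1h h →L[ℝ] H1h h :=
  (h / √6) ^ 2 • (ContinuousLinearMap.compL ℝ (H1h h) L2 (H1h h) (Linv h)).comp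
    (((ContinuousLinearMap.compL ℝ (H1h h) L2 L2).flip val).comp mulL2)

theorem pert_apply (h : ℝ) (g : C(Circ, ℝ)) (v : H1h h) :
    pert h g v = (h / √6) ^ 2 • Linv h (mulL2 g (val v)) := rfl

theorem norm_pert_le (h : ℝ) (g : C(Circ, ℝ)) : ‖pert h g‖ ≤ (h / √6) ^ 2 * ‖g‖ := by
  refine ContinuousLinearMap.opNorm_le_bound _ (by positivity) fun v => ?_
  rw [pert_apply, norm_smul, Real.norm_of_nonneg (sq_nonneg _), mul_assoc]
  gcongr
  refine (norm_Linv_le h _).trans ((norm_mulL2_le _ _).trans ?_)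
  gcongr
  exact norm_val_le v

theorem inner_eq_integral (v w : L2) : ⟪v, w⟫_ℝ = ∫ x, v x * w x ∂circMeas := by
  rw [L2.inner_def]
  refine integral_congr_ae (Filter.Eventually.of_forall fun x => ?_)
  simp [mul_comm]

theorem scale_sq (h : ℝ) : (h / √6) ^ 2 = h ^ 2 / 6 := by
  rw [div_pow, Real.sq_sqrt (by norm_num)]

/-- The weak form is the $H^1_h$ inner product of $v-a^2L^{-1}(f'(u)v)$ with the test function, so
applying $L^{-1}$ turns it into an operator equation. -/
theorem solvesK_iff {f : ℝ → ℝ} (hf : Continuous (deriv f)) {h : ℝ} (hh : 0 < h) (u : H1)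
    {z : Circ → ℝ} {Z : L2} (hz : z =ᵐ[circMeas] Z) (v : H1h h) :
    SolvesK f h u z v ↔ v - pert h (superpose hf (contRep u)) v = Linv h Z := by
  have key : ∀ ψ : H1h h,
      (∫ x, val v x * val (toH1 (scale_ne hh) ψ) x ∂circMeas)
      - h ^ 2 / 6 * (∫ x, deriv f (val u x) * val v x * val (toH1 (scale_ne hh) ψ) x ∂circMeas)
      + h ^ 2 / 6 * (∫ x, dx v x * dx (toH1 (scale_ne hh) ψ) x ∂circMeas)
        = ⟪v - pert h (superpose hf (contRep u)) v, ψ⟫_ℝ := by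
    intro ψ
    rw [val_toH1, dx_toH1, inner_sub_left, pert_apply, real_inner_smul_left, inner_Linv,
      inner_eq (scale_ne hh), scale_sq, inner_eq_integral, inner_eq_integral, inner_eq_integral]
    have h1 : ∫ x, deriv f (val u x) * val v x * val ψ x ∂circMeas
        = ∫ x, mulL2 (superpose hf (contRep u)) (val v) x * val ψ x ∂circMeas := by
      refine integral_congr_ae ?_
      filter_upwards [mulL2_ae_eq (superpose hf (contRep u)) (val v), contRep_ae_eq u]
        with x h1 h2
      rw [h1, ← h2]
      rfl
    rw [h1]
    ring
  have key2 : ∀ ψ : H1h h, ∫ x, z x * val (toH1 (scale_ne hh) ψ) x ∂circMeas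
      = ⟪Linv h Z, ψ⟫_ℝ := by
    intro ψ
    rw [inner_Linv, inner_eq_integral]
    refine integral_congr_ae ?_
    filter_upwards [hz] with x hx
    rw [hx, val_toH1]
  unfold SolvesK
  rw [(toH1_surjective (scale_ne hh)).forall]
  simp only [key, key2]
  exact ⟨fun H => ext_inner_right ℝ H, fun H ψ => by rw [H]⟩

theorem isUnit_one_sub_pert {h : ℝ} {g : C(Circ, ℝ)} (hg : ‖pert h g‖ ≤ 1 / 2) :
    IsUnit (1 - pert h g) :=
  isUnit_one_sub_of_norm_lt_one (hg.trans_lt (by norm_num))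

/-- The norm bound makes $1-$`pert` a unit by the Neumann series; at a non-unit `Ring.inverse` would
take the default value 0. -/
theorem sub_pert_eq_iff {h : ℝ} {g : C(Circ, ℝ)} (hg : ‖pert h g‖ ≤ 1 / 2) (v w : H1h h) :
    v - pert h g v = w ↔ v = Ring.inverse (1 - pert h g) w := by
  have hu := isUnit_one_sub_pert hg
  have h1 : (1 - pert h g) v = v - pert h g v := rfl
  rw [← h1]
  constructor
  · rintro rfl
    rw [← mul_apply_eq_comp, Ring.inverse_mul_cancel _ hu,
      one_apply_eq_self]
  · rintro rfl
    rw [← mul_apply_eq_comp, Ring.mul_inverse_cancel _ hu,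
      one_apply_eq_self]

end WeakSolution

/-! ### The nonlinearity $b(U)$ and its estimates uniform in $h$. -/

section Forcing

variable {f : ℝ → ℝ} (h0 : Continuous f) (h1 : Continuous (deriv f))
  (h2 : Continuous (deriv (deriv f)))

/-- The right-hand side of the equation determining `b(U)`, as an element of `L²`. -/
def sourceL2 {h : ℝ} (hh : 0 < h) (U : Energy h) : L2 :=
  -- The powers of $h$ are distributed so that each factor is bounded uniformly: one $a$ goes to
  -- $L^{-1}\partial_{xx}u$, and in $\frac{h^2}{12}p^2=\frac a2(ap)p$ one goes to the factor
  -- measured in the sup norm.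
  (h / √6) • mulL2 (superpose h1 (contRep U.fst)) (val ((h / √6) • LinvDxx h U.fst))
    + contToL2 (superpose h0 (contRep U.fst))
    + (h / √6 / 2) • mulL2 (superpose h2 (contRep U.fst))
        (mulL2 (contRep ((h / √6) • toH1 (scale_ne hh) U.snd)) (val U.snd))

theorem source_ae_eq {h : ℝ} (hh : 0 < h) (U : Energy h) :
    source f h U =ᵐ[circMeas] sourceL2 h0 h1 h2 hh U := by
  rw [sourceL2, map_smul, map_smul, map_smul, map_smul, smul_apply, map_smul, smul_smul, smul_smul,
    ← pow_two, show h / √6 / 2 * (h / √6) = (h / √6) ^ 2 / 2 by ring, scale_sq]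
  set a := mulL2 (superpose h1 (contRep U.fst)) (val (LinvDxx h U.fst)) with ha
  set c := contRep (toH1 (scale_ne hh) U.snd) with hc
  set b := mulL2 (superpose h2 (contRep U.fst)) (mulL2 c (val U.snd)) with hb
  filter_upwards [Lp.coeFn_add ((h ^ 2 / 6) • a + contToL2 (superpose h0 (contRep U.fst)))
      ((h ^ 2 / 6 / 2) • b), Lp.coeFn_add ((h ^ 2 / 6) • a)
      (contToL2 (superpose h0 (contRep U.fst))), Lp.coeFn_smul (h ^ 2 / 6) a,
    Lp.coeFn_smul (h ^ 2 / 6 / 2) b, contToL2_ae_eq (superpose h0 (contRep U.fst)),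
    mulL2_ae_eq (superpose h1 (contRep U.fst)) (val (LinvDxx h U.fst)),
    mulL2_ae_eq (superpose h2 (contRep U.fst)) (mulL2 c (val U.snd)),
    mulL2_ae_eq c (val U.snd), contRep_ae_eq U.fst,
    contRep_ae_eq (toH1 (scale_ne hh) U.snd)] with x e1 e2 e3 e4 e5 e6 e7 e8 e9 e10
  rw [e1, Pi.add_apply, e2, Pi.add_apply, e3, Pi.smul_apply, e4, Pi.smul_apply, e5, ha, e6, hb, e7,
    e8, hc, e10, val_toH1]
  simp only [superpose, ContinuousMap.comp_apply, ContinuousMap.coe_mk, e9, source, smul_eq_mul]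
  ring

/-- The nonlinearity `b(U)`. -/
def forcing {h : ℝ} (hh : 0 < h) (U : Energy h) : H1h h :=
  Ring.inverse (1 - pert h (superpose h1 (contRep U.fst))) (Linv h (sourceL2 h0 h1 h2 hh U))

theorem solvesK_source_iff {h : ℝ} (hh : 0 < h) {U : Energy h}
    (hU : ‖pert h (superpose h1 (contRep U.fst))‖ ≤ 1 / 2) (v : H1h h) :
    SolvesK f h U.fst (source f h U) v ↔ v = forcing h0 h1 h2 hh U := by
  rw [solvesK_iff h1 hh U.fst (source_ae_eq h0 h1 h2 hh U) v, sub_pert_eq_iff hU]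
  rfl

theorem existsUnique_solvesK {h : ℝ} (hh : 0 < h) {u : H1}
    (hu : ‖pert h (superpose h1 (contRep u))‖ ≤ 1 / 2) (z : L2) :
    ∃! v : H1h h, SolvesK f h u z v := by
  simp only [solvesK_iff h1 hh u (Filter.EventuallyEq.refl _ z), sub_pert_eq_iff hu]
  exact existsUnique_eq

/-- Three derivatives suffice because $f''$ must be locally Lipschitz. All constants come from
bounds for $f,f',f''$ on the interval of radius `sobolevConst * R`, which contains the values of
$u$. -/
theorem exists_bddLipOn_forcing (hf : ContDiff ℝ 3 f) {R : ℝ} (hR : 0 ≤ R) :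
    ∃ hstar B K : ℝ, 0 < hstar ∧ 0 ≤ B ∧ 0 ≤ K ∧ ∀ (h : ℝ) (hh : 0 < h), h ≤ hstar →
      (∀ U : Energy h, ‖U‖ ≤ R → ‖pert h (superpose h1 (contRep U.fst))‖ ≤ 1 / 2) ∧
      BddLipOn R (forcing h0 h1 h2 hh) B K := by
  have hf1 : ContDiff ℝ 2 (deriv f) := by
    have : ContDiff ℝ (2 + 1) f := by simpa using hf.of_le (by norm_num)
    exact (contDiff_succ_iff_deriv.1 this).2.2
  have hf2 : ContDiff ℝ 1 (deriv (deriv f)) := by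
    have : ContDiff ℝ (1 + 1) (deriv f) := by simpa using hf1.of_le (by norm_num)
    exact (contDiff_succ_iff_deriv.1 this).2.2
  obtain ⟨B₀, K₀, hB₀, hK₀, H₀⟩ :=
    exists_bddLipOn_real (hf.of_le (by norm_num)) (sobolevConst * R)
  obtain ⟨B₁, K₁, hB₁, hK₁, H₁⟩ :=
    exists_bddLipOn_real (hf1.of_le (by norm_num)) (sobolevConst * R)
  obtain ⟨B₂, K₂, hB₂, hK₂, H₂⟩ := exists_bddLipOn_real hf2 (sobolevConst * R)
  have hc := sobolevConst_nonneg
  set c := sobolevConst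
  -- `S` bounds the source in $L^2$ and `K` is its Lipschitz constant. The choice of $h_*$ gives
  -- $a\le1$ and $a^2B_1\le\frac12$, as the Neumann series requires.
  let S := B₁ * (1 * R) + B₀ + B₂ * (c * R * (1 * R))
  let K := (K₁ * c * (1 * R) + B₁ * 1) + K₀ * c
    + (K₂ * c * (c * R * (1 * R)) + B₂ * (c * (1 * R) + c * R * 1))
  refine ⟨1 / (2 * (B₁ + 1)), 2 * S, 2 * (K + K₁ * c * (2 * S)), by positivity, by positivity,
    by positivity, fun h hh hle => ?_⟩
  have ha0 : 0 < h / √6 := by positivity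
  have hah : h / √6 ≤ h := div_le_self hh.le (Real.one_le_sqrt.2 (by norm_num))
  have ha2 : (h / √6) * (2 * (B₁ + 1)) ≤ 1 := by
    rw [← le_div_iff₀ (by positivity)]
    exact hah.trans hle
  have ha1 : h / √6 ≤ 1 := by nlinarith
  have haabs : |h / √6| ≤ 1 := by rwa [abs_of_pos ha0]
  have haabs2 : |h / √6 / 2| ≤ 1 := by rw [abs_of_pos (by positivity)]; linarith
  have hsq : (h / √6) ^ 2 ≤ 1 := pow_le_one₀ ha0.le ha1
  have hfst : ∀ U : Energy h, ‖U.fst‖ ≤ ‖U‖ := fun U =>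
    (sq_le_sq₀ (norm_nonneg _) (norm_nonneg _)).1 (by
      rw [WithLp.prod_norm_sq_eq_of_L2]; linarith [sq_nonneg ‖U.snd‖])
  have hsnd : ∀ U : Energy h, ‖U.snd‖ ≤ ‖U‖ := fun U =>
    (sq_le_sq₀ (norm_nonneg _) (norm_nonneg _)).1 (by
      rw [WithLp.prod_norm_sq_eq_of_L2]; linarith [sq_nonneg ‖U.fst‖])
  have hu : BddLipOn R (fun U : Energy h => contRep U.fst) (c * R) c :=
    .of_linear (contRep.comp (WithLp.fstL 2 ℝ H1 (H1h h))) hc fun U =>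
      (norm_contRep_le _).trans (by gcongr; exact hfst U)
  have hq : BddLipOn R (fun U : Energy h => val ((h / √6) • LinvDxx h U.fst)) (1 * R) 1 :=
    .of_linear (val.comp ((h / √6) • (LinvDxx h).comp (WithLp.fstL 2 ℝ H1 (H1h h)))) zero_le_one
      fun U => by
        rw [one_mul]
        exact (norm_val_le _).trans ((norm_smul_LinvDxx_le hh U.fst).trans (hfst U))
  have hp : BddLipOn R (fun U : Energy h => val U.snd) (1 * R) 1 :=
    .of_linear (val.comp (WithLp.sndL 2 ℝ H1 (H1h h))) zero_le_one fun U => by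
      rw [one_mul]; exact (norm_val_le _).trans (hsnd U)
  have hP : BddLipOn R (fun U : Energy h => contRep ((h / √6) • toH1 (scale_ne hh) U.snd))
      (c * R) c :=
    .of_linear (contRep.comp
      ((h / √6) • (toH1 (scale_ne hh)).comp (WithLp.sndL 2 ℝ H1 (H1h h)))) hc fun U =>
      (norm_contRep_le _).trans
        (by gcongr; exact (norm_smul_toH1_le ha0 ha1 U.snd).trans (hsnd U))
  have F0 := (H₀.superpose hB₀ hK₀ h0).comp hu hK₀
  have F1 := (H₁.superpose hB₁ hK₁ h1).comp hu hK₁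
  have F2 := (H₂.superpose hB₂ hK₂ h2).comp hu hK₂
  have hS := (((F1.bilin hq hR mulL2 norm_mulL2_le).smul haabs).add
    (F0.linear_comp contToL2 norm_contToL2_le)).add
    ((F2.bilin (hP.bilin hp hR mulL2 norm_mulL2_le) hR mulL2 norm_mulL2_le).smul haabs2)
  have hpert : BddLipOn R (fun U : Energy h => pert h (superpose h1 (contRep U.fst))) (1 / 2)
      (K₁ * c) := by
    refine ⟨fun U hU => (norm_pert_le h _).trans ?_, fun U V hU hV => ?_⟩
    · calc (h / √6) ^ 2 * _ ≤ (h / √6) ^ 2 * B₁ := by gcongr; exact F1.1 U hU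
        _ ≤ 1 / 2 := by nlinarith
    · rw [← map_sub]
      exact (norm_pert_le h _).trans
        ((mul_le_of_le_one_left (norm_nonneg _) hsq).trans (F1.2 U V hU hV))
  refine ⟨hpert.1, ?_⟩
  exact hpert.of_sub_eq (b := forcing h0 h1 h2 hh)
    (hS.linear_comp (Linv h) (norm_Linv_le h)) (by positivity)
    fun U hU => (sub_pert_eq_iff (hpert.1 U hU) _ _).2 rfl

end Forcing

/-- The map `β ↦ (0, β)` into the energy space. -/
def inr (h : ℝ) : H1h h →L[ℝ] Energy h :=
  ((WithLp.prodContinuousLinearEquiv 2 ℝ H1 (H1h h)).symm :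
    H1 × H1h h →L[ℝ] Energy h).comp (ContinuousLinearMap.inr ℝ H1 (H1h h))

theorem inr_apply (h : ℝ) (β : H1h h) : inr h β = WithLp.toLp 2 (0, β) := rfl

theorem norm_inr (h : ℝ) (β : H1h h) : ‖inr h β‖ = ‖β‖ := by
  refine (sq_eq_sq₀ (norm_nonneg _) (norm_nonneg _)).1 ?_
  rw [inr_apply, WithLp.prod_norm_sq_eq_of_L2]
  simp

end ModifiedWave

end

/-! ### Local well-posedness. -/

open ModifiedWave
open scoped ContDiff
theorem mainTheorem1 (f : ℝ → ℝ) (hf : ContDiff ℝ ∞ f) :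
    ∀ C : ℝ, 0 < C → ∃ T : ℝ, 0 < T ∧ ∃ hstar : ℝ, 0 < hstar ∧ ∃ R : ℝ, 0 < R ∧
      ∀ (h : ℝ) (hh : 0 < h), h ≤ hstar →
        ∀ U₀ : Energy h, ‖U₀‖ ≤ C →
          ∃ U : ℝ → Energy h,
            IsMildSolution f hh T U₀ U ∧
            (∀ t ∈ Set.Icc 0 T, ‖U t‖ ≤ R) ∧
            (∀ t ∈ Set.Icc 0 T, ∀ z : L2, ∃! v : H1h h, SolvesK f h (U t).fst z v) ∧
            ∀ V : ℝ → Energy h, IsMildSolution f hh T U₀ V → Set.EqOn V U (Set.Icc 0 T) := by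
  intro C hC
  have hf3 : ContDiff ℝ 3 f := contDiff_infty.1 hf 3
  have hf1 : ContDiff ℝ ∞ (deriv f) := (contDiff_infty_iff_deriv.1 hf).2
  have hf2 : ContDiff ℝ ∞ (deriv (deriv f)) := (contDiff_infty_iff_deriv.1 hf1).2
  have h0 := hf.continuous
  have h1 := hf1.continuous
  have h2 := hf2.continuous
  -- The factor 2 bounds the group on $[0,1]$. The radius is fixed before `B` and `K`, which depend
  -- on it; then $2BT\le\frac12$ keeps solutions strictly inside the ball.
  let R : ℝ := 2 * C + 2
  have hRpos : 0 < R := by positivity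
  obtain ⟨hstar, B, K, hstar0, hB, hK, H⟩ := exists_bddLipOn_forcing h0 h1 h2 hf3 hRpos.le
  let T : ℝ := 1 / (4 * (B + K + 1))
  have hT0 : 0 < T := by positivity
  have hTeq : T * (4 * (B + K + 1)) = 1 := one_div_mul_cancel (by positivity)
  have hT1 : T ≤ 1 := by nlinarith [mul_nonneg hT0.le hB, mul_nonneg hT0.le hK]
  have hBT : 2 * B * T ≤ 1 / 2 := by nlinarith [mul_nonneg hT0.le hB, mul_nonneg hT0.le hK]
  have hKT : 2 * K * T ≤ 1 / 2 := by nlinarith [mul_nonneg hT0.le hB, mul_nonneg hT0.le hK]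
  refine ⟨T, hT0, hstar, hstar0, R, hRpos, fun h hh hle U₀ hU₀ => ?_⟩
  obtain ⟨Hpert, HG⟩ := H h hh hle
  have HE := HG.linear_comp (inr h) fun β => (norm_inr h β).le
  have hSc : Continuous (waveGroup hh) := continuous_expOp _
  have hS : ∀ t ∈ Set.Icc 0 T, ‖waveGroup hh t‖ ≤ 2 := fun t ht =>
    norm_waveGroup_le hh ⟨ht.1, ht.2.trans hT1⟩
  have hR : 2 * ‖U₀‖ + 2 * B * T < R := by
    change _ < 2 * C + 2
    linarith
  obtain ⟨U, hUc, hUR, hGc, hUd⟩ :=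
    exists_eq_duhamel hSc hT0.le hS zero_le_two hB hK HE.1 HE.2 hR.le hKT
  have hfc : Continuous fun t => forcing h0 h1 h2 hh (U t) :=
    (WithLp.sndL 2 ℝ H1 (H1h h)).continuous.comp hGc
  refine ⟨U, ⟨hUc.continuousOn, fun t => forcing h0 h1 h2 hh (U t), fun t _ => ?_, ?_, hUd⟩,
    fun t _ => hUR t, fun t _ z => existsUnique_solvesK h1 hh (Hpert _ (hUR t)) z, ?_⟩
  · exact (solvesK_source_iff h0 h1 h2 hh (Hpert _ (hUR t)) _).2 rfl
  · exact hfc.intervalIntegrable _ _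
  · rintro V ⟨hVc, β, hβ, -, hVd⟩
    -- No bound on $V$ is known yet, so its forcing is identified with $b(V)$ only while $V$ lies in
    -- the ball; this is all the exit-time argument needs.
    have hβ' : ∀ t ∈ Set.Icc 0 T, ‖V t‖ ≤ R →
        inr h (β t) = inr h (forcing h0 h1 h2 hh (V t)) := fun t ht hVR =>
      congrArg _ ((solvesK_source_iff h0 h1 h2 hh (Hpert _ hVR) _).1 (hβ t ht))
    have hVR := norm_lt_of_eq_duhamel hS zero_le_two hB hR hVc (γ := fun t => inr h (β t))
      (fun t ht hle => by rw [hβ' t ht hle]; exact HE.1 _ hle) hVd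
    exact eqOn_of_eq_duhamel hSc hT0.le hS zero_le_two hK HE.2 hKT hUc.continuousOn hVc
      (fun t _ => hUR t) (fun t ht => (hVR t ht).le) (fun t _ => rfl)
      (fun t ht => hβ' t ht (hVR t ht).le) hUd hVd
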